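/- **Theorem 3.2.** For $t\ge 0$ let $$P(t,u)=\frac{e^{t\sqrt{1-u^2}}\,\mathbf 1_{[-1,1]}(u)}{\int_{-1}^{1}e^{t\sqrt{1-v^2}}\,dv},\qquad p^{(N)}(t,u)=\int_{\mathbb R^N}\delta\Big(u-\frac1N\sum_{i=1}^N u_i\Big)\prod_{i=1}^N P\Big(\frac tN,u_i\Big)\,du_i ,$$ so that $p^{(N)}(t,\cdot)$ is the density of the mean of $N$ independent random variables with density $P(t/N,\cdot)$; explicitly, $$p^{(N)}(t,u)=N\int_{\mathbb R^{N-1}}\prod_{i=1}^{N-1}P\Big(\frac tN,u_i\Big)\;P\Big(\frac tN,\,Nu-\sum_{i=1}^{N-1}u_i\Big)\,du_1\cdots du_{N-1}.$$ Suppose that there are real functions $y(u)$, $f(\tau,y)$, $A_N(y)$ such that $(\tau,u)\mapsto f(\tau,y(u))$ is twice continuously differentiable on $\mathbb R\times(-1,1)$ and even in $u$, such that $A_N(y(u))/A_{N-1}(y(u))\to1$ as $N\to\infty$ for every $u\in(-1,1)$, and such that for every fixed $t\ge0$ and $u\in(-1,1)$, with $\tau=t/N$, $$p^{(N)}(N\tau,u)=A_N(y(u))\,e^{N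 f(\tau,y(u))}\Big(1+O\Big(\frac1N\Big)\Big),\qquad N\to\infty .$$ Let $f_2(u)=\partial_\tau f(\tau,y(u))\big|_{\tau=0}$ for $u\in(-1,1)$. Then $f_2$ is given parametrically by $$f_2=\frac{\pi}{2}\Big(\frac{I_1(s)}{\sinh s}-\frac12\Big),\qquad u=\frac1s-\coth s,\qquad s\in\mathbb R\setminus\{0\},$$ and $f_2(0)=0$, where $I_1(s)=\sum_{k\ge0}\frac{(s/2)^{2k+1}}{k!\,(k+1)!}$ is the modified Bessel function of the first kind of order one. Here $s\mapsto \frac1s-\coth s$, extended by $0\mapsto0$, is a bijection from $\mathbb R$ onto $(-1,1)$, so that $f_2$ is determined on all of $(-1,1)$. -/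

import Mathlib

open Real Set Filter Topology Asymptotics MeasureTheory

noncomputable section

/-- The normalized one-step density `P(t,u)`, proportional to `exp (t √(1 - u²))` on `[-1,1]`
and zero outside. -/
def stepDensity (t u : ℝ) : ℝ :=
  (Icc (-1 : ℝ) 1).indicator (fun v => exp (t * √(1 - v ^ 2))) u /
    ∫ v in (-1 : ℝ)..1, exp (t * √(1 - v ^ 2))

/-- The path-integral sequence
`p^(N)(t,u) = ∫ δ(u - (u₁ + ⋯ + u_N)/N) ∏ P(t/N, u_i) du_i`,
that is, the value at `u` of the density of the mean of `N` independent variables with density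
`P(t/N, ·)`.  The delta function is integrated out in the last variable,
`u_N = N u - (u₁ + ⋯ + u_{N-1})`, which produces the Jacobian factor `N`. -/
def pathDensity (N : ℕ) (t u : ℝ) : ℝ :=
  N * ∫ v : Fin (N - 1) → ℝ,
    (∏ i, stepDensity (t / N) (v i)) * stepDensity (t / N) (N * u - ∑ i, v i)

/-- The modified Bessel function of the first kind of order one, by its (everywhere convergent)
power series `I₁(y) = ∑ (y/2)^(2k+1) / (k! (k+1)!)`. -/
def besselI1 (y : ℝ) : ℝ :=
  ∑' k : ℕ, (y / 2) ^ (2 * k + 1) / ((k.factorial : ℝ) * ((k + 1).factorial : ℝ))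

/-- The parametrization `u = 1/y - coth y`, with its limiting value `0` at `y = 0`. -/
def velocity (y : ℝ) : ℝ :=
  if y = 0 then 0 else 1 / y - cosh y / sinh y

/-- The ansatz `p^(N)(Nτ,u) = A_N(y(u)) exp (N f(τ,y(u))) (1 + O(1/N))` for `-1 < u < 1`, in the
regime `Nτ = t` with `t ≥ 0` fixed and `N → ∞`.  The functions `y`, `f` and `A_N` are unknown;
`(τ,u) ↦ f(τ,y(u))` is twice continuously differentiable and even in `u`, and
`A_N / A_{N-1} → 1`. -/
structure AsymptoticAnsatz (y : ℝ → ℝ) (f : ℝ → ℝ → ℝ) (A : ℕ → ℝ → ℝ) : Prop where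
  contDiffOn : ContDiffOn ℝ 2 (fun q : ℝ × ℝ => f q.1 (y q.2)) (univ ×ˢ Ioo (-1 : ℝ) 1)
  even : ∀ τ : ℝ, ∀ u ∈ Ioo (-1 : ℝ) 1, f τ (y (-u)) = f τ (y u)
  ratio : ∀ u ∈ Ioo (-1 : ℝ) 1,
    Tendsto (fun N : ℕ => A N (y u) / A (N - 1) (y u)) atTop (𝓝 1)
  asymptotics : ∀ t : ℝ, 0 ≤ t → ∀ u ∈ Ioo (-1 : ℝ) 1,
    ∃ r : ℕ → ℝ, r =O[atTop] (fun N : ℕ => 1 / (N : ℝ)) ∧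
      ∀ᶠ N : ℕ in atTop,
        pathDensity N t u = A N (y u) * exp (N * f (t / N) (y u)) * (1 + r N)

end

/-! Compare `p^(N)(t,u)` at `t = 1` and `t = 0`. Under the ansatz `A_N` cancels and `N (f(1/N, y(u))
- f(0, y(u)))` is a difference quotient, so the ratio tends to `exp (f₂ u)`
(`AsymptoticAnsatz.tendsto_ratio`).

Computed directly, the ratio is `(Z(0)/Z(1/N))^N`, with `Z` the normalizer of `P`, times the
expectation of `exp ((1/N) ∑ √(1 - uᵢ²))` over uniform steps conditioned to have mean `u`. The first
factor tends to `exp (-π/4)`. The conditional law does not change when each step is tilted by `exp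
(-s v)`; taking `s` with `u = 1/s - coth s` makes `u` the tilted mean. The average of `√(1 - uᵢ²)`
then concentrates at its tilted expectation, which is `(π/2) I₁(s)/sinh s` for `s ≠ 0`
(`tendsto_conditional_exp_mean`).

The conditioning event is null, so the exponential bound of Hoeffding has to beat the density of the
tilted sum at its mean. No local limit theorem is needed: a subexponential lower bound suffices
(`eventually_le_stepAverage`). A small fraction of the steps supplies a density bounded below on a
window, and the remaining steps land in that window with probability at least 1/2. -/

/-! ### Integrals against the exponential tilt -/

/-- The normalizing constant of the density proportional to `exp (-s v)` on `[-1,1]`. -/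
noncomputable def tiltNormalizer (s : ℝ) : ℝ := ∫ v in (-1 : ℝ)..1, exp (-(s * v))

theorem tiltNormalizer_pos (s : ℝ) : 0 < tiltNormalizer s :=
  intervalIntegral.intervalIntegral_pos_of_pos
    (Continuous.intervalIntegrable (by fun_prop) _ _) (fun _ => exp_pos _) (by norm_num)

theorem tiltNormalizer_zero : tiltNormalizer 0 = 2 := by
  simp [tiltNormalizer]; norm_num

theorem tiltNormalizer_eq {s : ℝ} (hs : s ≠ 0) : tiltNormalizer s = 2 * sinh s / s := by
  have h : ∀ v ∈ uIcc (-1 : ℝ) 1,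
      HasDerivAt (fun v => -exp (-(s * v)) / s) (exp (-(s * v))) v := by
    intro v _
    have := (((((hasDerivAt_id v).const_mul s).neg).exp).neg).div_const s
    convert! this using 1
    simp only [id, mul_one, mul_neg, neg_neg]
    field_simp
    rfl
  rw [tiltNormalizer, intervalIntegral.integral_eq_sub_of_hasDerivAt h
    (Continuous.intervalIntegrable (by fun_prop) _ _), sinh_eq]
  simp only [mul_one, mul_neg, neg_neg]
  ring

/-- This is where the parametrization comes from: `velocity s` is the mean of the tilted law. -/
theorem integral_mul_exp_neg (s : ℝ) :
    ∫ v in (-1 : ℝ)..1, v * exp (-(s * v)) = velocity s * tiltNormalizer s := by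
  rcases eq_or_ne s 0 with rfl | hs
  · simp [velocity]
  have h : ∀ v ∈ uIcc (-1 : ℝ) 1,
      HasDerivAt (fun v => -(v / s + 1 / s ^ 2) * exp (-(s * v))) (v * exp (-(s * v))) v := by
    intro v _
    have h1 := ((((hasDerivAt_id v).const_mul s).neg).exp)
    have h2 := ((((hasDerivAt_id v).div_const s).add_const (1 / s ^ 2)).neg).mul h1
    convert! h2 using 1
    simp only [id, mul_one, mul_neg, Pi.neg_apply]
    field_simp
    ring
  have hsinh : sinh s ≠ 0 := by simpa using hs
  rw [intervalIntegral.integral_eq_sub_of_hasDerivAt h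
    (Continuous.intervalIntegrable (by fun_prop) _ _), tiltNormalizer_eq hs, velocity, if_neg hs]
  field_simp
  rw [sinh_eq, cosh_eq]
  ring

/-- The function `v^(2k+1) (1 - v²)^(3/2)` vanishes at `±1`; integrating its derivative gives the
recursion `(2k+1) J_k = (2k+4) J_{k+1}`. -/
theorem integral_even_pow_mul_sqrt (k : ℕ) :
    ∫ v in (-1 : ℝ)..1, v ^ (2 * k) * √(1 - v ^ 2) =
      π * (2 * k).factorial / (2 * 4 ^ k * k.factorial * (k + 1).factorial) := by
  induction k with
  | zero => simp [integral_sqrt_one_sub_sq]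
  | succ k ih =>
    have key : ∀ v ∈ Ioo (-1 : ℝ) 1,
        HasDerivAt (fun v => v ^ (2 * k + 1) * ((1 - v ^ 2) * √(1 - v ^ 2)))
          ((2 * k + 1) * (v ^ (2 * k) * √(1 - v ^ 2))
            - (2 * k + 4) * (v ^ (2 * (k + 1)) * √(1 - v ^ 2))) v := by
      intro v hv
      have hpos : 0 < 1 - v ^ 2 := by nlinarith [hv.1, hv.2]
      have h0 : HasDerivAt (fun v : ℝ => 1 - v ^ 2) (-(2 * v)) v := by
        simpa using ((hasDerivAt_pow 2 v).const_sub 1)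
      have h1 := (hasDerivAt_pow (2 * k + 1) v).mul (h0.mul (h0.sqrt hpos.ne'))
      convert! h1 using 1
      have hs : √(1 - v ^ 2) ≠ 0 := (sqrt_pos.2 hpos).ne'
      have hsq : √(1 - v ^ 2) ^ 2 = 1 - v ^ 2 := sq_sqrt hpos.le
      have : (1 - v ^ 2) * (-(2 * v) / (2 * √(1 - v ^ 2))) = -v * √(1 - v ^ 2) := by
        rw [mul_div_assoc', div_eq_iff (by positivity)]; linear_combination (2 * v) * hsq
      rw [this, Nat.add_sub_cancel, Pi.mul_apply]
      push_cast
      ring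
    have hint : ∀ j : ℕ, IntervalIntegrable (fun v : ℝ => v ^ (2 * j) * √(1 - v ^ 2))
        volume (-1) 1 := fun j => Continuous.intervalIntegrable (by fun_prop) _ _
    have h := intervalIntegral.integral_eq_sub_of_hasDerivAt_of_le (by norm_num)
      (Continuous.continuousOn (by fun_prop)) key
      (((hint k).const_mul _).sub ((hint (k + 1)).const_mul _))
    rw [intervalIntegral.integral_sub ((hint k).const_mul _) ((hint (k + 1)).const_mul _),
      intervalIntegral.integral_const_mul, intervalIntegral.integral_const_mul, ih] at h
    norm_num at h
    have h4 : (2 * k + 4 : ℝ) ≠ 0 := by positivity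
    refine mul_left_cancel₀ h4 ?_
    rw [← sub_eq_zero.1 h]
    rw [show 2 * (k + 1) = 2 * k + 1 + 1 by ring, Nat.factorial_succ (2 * k + 1),
      Nat.factorial_succ (2 * k), Nat.factorial_succ (k + 1), Nat.factorial_succ k]
    push_cast
    field_simp
    ring

theorem integral_sqrt_mul_exp_neg_eq_cosh (s : ℝ) :
    ∫ v in (-1 : ℝ)..1, √(1 - v ^ 2) * exp (-(s * v)) =
      ∫ v in (-1 : ℝ)..1, cosh (s * v) * √(1 - v ^ 2) := by
  have h1 : ∫ v in (-1 : ℝ)..1, √(1 - v ^ 2) * exp (s * v) =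
      ∫ v in (-1 : ℝ)..1, √(1 - v ^ 2) * exp (-(s * v)) := by
    have := intervalIntegral.integral_comp_neg (a := -1) (b := 1)
      (fun v : ℝ => √(1 - v ^ 2) * exp (-(s * v)))
    simpa using this
  have h2 : ∀ v : ℝ, cosh (s * v) * √(1 - v ^ 2) =
      (√(1 - v ^ 2) * exp (s * v) + √(1 - v ^ 2) * exp (-(s * v))) / 2 := by
    intro v; rw [cosh_eq]; ring
  simp_rw [h2]
  rw [intervalIntegral.integral_div, intervalIntegral.integral_add
    (Continuous.intervalIntegrable (by fun_prop) _ _)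
    (Continuous.intervalIntegrable (by fun_prop) _ _), h1]
  ring

theorem sqrt_one_sub_sq_mem_Icc (v : ℝ) : √(1 - v ^ 2) ∈ Icc (0 : ℝ) 1 :=
  ⟨sqrt_nonneg _, sqrt_le_iff.2 ⟨zero_le_one, by nlinarith [sq_nonneg v]⟩⟩

/-- Only the even part `cosh` of the exponential contributes. Its series is integrated term by term,
dominated by the series of `cosh |s|`, and the even moments turn it into the Bessel series. -/
theorem integral_sqrt_mul_exp_neg {s : ℝ} (hs : s ≠ 0) :
    ∫ v in (-1 : ℝ)..1, √(1 - v ^ 2) * exp (-(s * v)) = π * besselI1 s / s := by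
  rw [integral_sqrt_mul_exp_neg_eq_cosh]
  have h := intervalIntegral.hasSum_integral_of_dominated_convergence (μ := volume)
    (a := (-1 : ℝ)) (b := 1) (F := fun (k : ℕ) (v : ℝ) => (s * v) ^ (2 * k) / (2 * k).factorial
      * √(1 - v ^ 2)) (f := fun v => cosh (s * v) * √(1 - v ^ 2))
    (fun k _ => |s| ^ (2 * k) / (2 * k).factorial)
    (fun k => (Continuous.aestronglyMeasurable (by fun_prop)))
    (fun k => ae_of_all _ fun v hv => by
      rw [uIoc_of_le (by norm_num)] at hv
      have hv1 : |v| ≤ 1 := abs_le.2 ⟨hv.1.le, hv.2⟩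
      rw [norm_mul, norm_div, norm_pow, Real.norm_natCast, norm_eq_abs, norm_eq_abs, abs_mul,
        abs_of_nonneg (sqrt_nonneg _)]
      have h2 : (|s| * |v|) ^ (2 * k) ≤ |s| ^ (2 * k) := by
        refine pow_le_pow_left₀ (by positivity) ?_ _
        exact mul_le_of_le_one_right (abs_nonneg _) hv1
      calc _ ≤ (|s| * |v|) ^ (2 * k) / (2 * k).factorial * 1 := by
            gcongr; exact (sqrt_one_sub_sq_mem_Icc v).2
        _ ≤ _ := by rw [mul_one]; gcongr)
    (ae_of_all _ fun v _ => (Real.hasSum_cosh |s|).summable)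
    (by simp)
    (ae_of_all _ fun v _ => (Real.hasSum_cosh (s * v)).mul_right _)
  rw [← h.tsum_eq, besselI1, ← tsum_mul_left, ← tsum_div_const]
  refine tsum_congr fun k => ?_
  have : ∀ v : ℝ, (s * v) ^ (2 * k) / (2 * k).factorial * √(1 - v ^ 2) =
      s ^ (2 * k) / (2 * k).factorial * (v ^ (2 * k) * √(1 - v ^ 2)) := by
    intro v; rw [mul_pow]; ring
  simp_rw [this]
  rw [intervalIntegral.integral_const_mul, integral_even_pow_mul_sqrt, div_pow, pow_succ 2,
    pow_mul 2, pow_succ s]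
  norm_num
  field_simp

/-! ### The parametrization is a bijection onto (-1, 1) -/

theorem velocity_neg (s : ℝ) : velocity (-s) = -velocity s := by
  unfold velocity
  by_cases hs : s = 0
  · simp [hs]
  · simp [hs, div_neg, neg_add_eq_sub]

theorem sinh_lt_mul_cosh {s : ℝ} (hs : 0 < s) : sinh s < s * cosh s := by
  have hm : StrictMonoOn (fun x : ℝ => x * cosh x - sinh x) (Ici 0) := by
    refine strictMonoOn_of_deriv_pos (convex_Ici 0) (by fun_prop) fun x hx => ?_
    rw [interior_Ici] at hx
    have h : HasDerivAt (fun x : ℝ => x * cosh x - sinh x) (x * sinh x) x := by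
      convert! ((hasDerivAt_id x).mul (hasDerivAt_cosh x)).sub (hasDerivAt_sinh x) using 1
      simp
    rw [h.deriv]
    exact mul_pos hx (sinh_pos_iff.2 hx)
  have := hm (mem_Ici.2 le_rfl) hs.le hs
  simp at this
  linarith

theorem velocity_of_pos {s : ℝ} (hs : 0 < s) : velocity s = 1 / s - cosh s / sinh s :=
  if_neg hs.ne'

theorem velocity_mem_of_pos {s : ℝ} (hs : 0 < s) : velocity s ∈ Ioo (-1 : ℝ) 0 := by
  have hsh : 0 < sinh s := sinh_pos_iff.2 hs
  have h1 := sinh_lt_mul_cosh hs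
  have h2 : s < sinh s := self_lt_sinh_iff.2 hs
  have h3 : cosh s - sinh s = exp (-s) := cosh_sub_sinh s
  have h4 : exp (-s) < 1 := by simpa using hs
  have e : velocity s = (sinh s - s * cosh s) / (s * sinh s) := by
    rw [velocity_of_pos hs]; field_simp
  rw [e]
  constructor
  · rw [lt_div_iff₀ (by positivity)]
    nlinarith
  · exact div_neg_of_neg_of_pos (by linarith) (by positivity)

theorem strictAntiOn_velocity : StrictAntiOn velocity (Ioi 0) := by
  have h : ∀ x ∈ Ioi (0 : ℝ), HasDerivAt (fun s => 1 / s - cosh s / sinh s)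
      (-1 / x ^ 2 - (sinh x * sinh x - cosh x * cosh x) / sinh x ^ 2) x := by
    intro x hx
    have hsh : sinh x ≠ 0 := (sinh_pos_iff.2 hx).ne'
    have hx0 : x ≠ 0 := ne_of_gt hx
    have h1 := (((hasDerivAt_const x (1 : ℝ)).div (hasDerivAt_id x) hx0)).sub
      ((hasDerivAt_cosh x).div (hasDerivAt_sinh x) hsh)
    convert! h1 using 1
    simp
  have hanti : StrictAntiOn (fun s => 1 / s - cosh s / sinh s) (Ioi (0 : ℝ)) := by
    refine strictAntiOn_of_deriv_neg (convex_Ioi 0)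
      (fun x hx => (h x hx).continuousAt.continuousWithinAt) fun x hx => ?_
    rw [interior_Ioi] at hx
    rw [(h x hx).deriv]
    have hx' : 0 < x := hx
    have hsh : 0 < sinh x := sinh_pos_iff.2 hx
    have h2 : x < sinh x := self_lt_sinh_iff.2 hx
    have h3 : sinh x * sinh x - cosh x * cosh x = -1 := by nlinarith [cosh_sq x]
    rw [h3]
    have : 1 / sinh x ^ 2 < 1 / x ^ 2 := by gcongr
    have e1 : (-1 : ℝ) / sinh x ^ 2 = -(1 / sinh x ^ 2) := by ring
    have e2 : (-1 : ℝ) / x ^ 2 = -(1 / x ^ 2) := by ring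
    rw [e1, e2]; linarith
  exact hanti.congr fun x hx => (velocity_of_pos hx).symm

theorem continuousOn_velocity : ContinuousOn velocity (Ioi 0) := by
  have : ContinuousOn (fun s => 1 / s - cosh s / sinh s) (Ioi (0 : ℝ)) :=
    (continuousOn_const.div continuousOn_id fun x hx => ne_of_gt hx).sub
      (continuous_cosh.continuousOn.div continuous_sinh.continuousOn
        fun x hx => (sinh_pos_iff.2 hx).ne')
  exact this.congr fun x hx => velocity_of_pos hx

/-- With `velocity_lt_of_pos`, this explicit bound replaces the limits at `0` and `∞` in the
intermediate value argument. -/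
theorem neg_lt_velocity_of_pos {s : ℝ} (hs : 0 < s) : -s < velocity s := by
  have hsh : 0 < sinh s := sinh_pos_iff.2 hs
  have h2 : s < sinh s := self_lt_sinh_iff.2 hs
  have h3 : cosh s - sinh s = exp (-s) := cosh_sub_sinh s
  have h4 : exp (-s) < 1 := by simpa using hs
  have h5 := add_one_le_exp (-s)
  -- In half angles this follows from `sinh (s/2) < (s/2) cosh (s/2)`.
  have h6 : cosh s ≤ 1 + s * sinh s := by
    have e1 : cosh s = 2 * sinh (s / 2) ^ 2 + 1 := by
      have := cosh_two_mul (s / 2)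
      rw [cosh_sq] at this
      rw [show s = 2 * (s / 2) by ring, this]; ring_nf
    have e2 : sinh s = 2 * sinh (s / 2) * cosh (s / 2) := by
      rw [← sinh_two_mul]; ring_nf
    have e3 := sinh_lt_mul_cosh (half_pos hs)
    have e4 : 0 < sinh (s / 2) := sinh_pos_iff.2 (half_pos hs)
    rw [e1, e2]
    nlinarith [mul_lt_mul_of_pos_left e3 e4, cosh_pos (s / 2), mul_pos e4 (cosh_pos (s / 2))]
  rw [velocity_of_pos hs]
  have e : 1 / s - cosh s / sinh s = (sinh s - s * cosh s) / (s * sinh s) := by field_simp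
  rw [e, lt_div_iff₀ (by positivity)]
  nlinarith

theorem velocity_lt_of_pos {s : ℝ} (hs : 0 < s) : velocity s < 1 / s - 1 := by
  have hsh : 0 < sinh s := sinh_pos_iff.2 hs
  rw [velocity_of_pos hs]
  have : 1 < cosh s / sinh s := (one_lt_div hsh).2 (sinh_lt_cosh s)
  linarith

theorem exists_pos_velocity_eq {u : ℝ} (hu : u ∈ Ioo (-1 : ℝ) 0) : ∃ s, 0 < s ∧ velocity s = u := by
  have h1 : 0 < -u / 2 := by linarith [hu.2]
  have h3 : 0 < 1 / (1 + u) := by have := hu.1; exact one_div_pos.2 (by linarith)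
  -- The value at `-u/2` exceeds `u/2 > u`; the value at `1/(1+u)` is below `(1+u) - 1 = u`.
  have a1 := neg_lt_velocity_of_pos h1
  have a2 := velocity_lt_of_pos h3
  rw [one_div_one_div] at a2
  have := isPreconnected_Ioi.intermediate_value (a := 1 / (1 + u)) (b := -u / 2) h3 h1
    continuousOn_velocity
  obtain ⟨s, hs, h⟩ : u ∈ velocity '' Ioi 0 := this ⟨by linarith, by linarith [hu.2]⟩
  exact ⟨s, hs, h⟩

theorem velocity_zero : velocity 0 = 0 := if_pos rfl

theorem bijOn_velocity : BijOn velocity univ (Ioo (-1 : ℝ) 1) := by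
  have hneg : ∀ s < 0, velocity s ∈ Ioo (0 : ℝ) 1 := by
    intro s hs
    have := velocity_mem_of_pos (neg_pos.2 hs)
    rw [velocity_neg] at this
    exact ⟨by linarith [this.2], by linarith [this.1]⟩
  refine ⟨fun s _ => ?_, ?_, fun u hu => ?_⟩
  · rcases lt_trichotomy s 0 with h | rfl | h
    · exact ⟨by linarith [(hneg s h).1], (hneg s h).2⟩
    · simp [velocity_zero]
    · exact ⟨(velocity_mem_of_pos h).1, by linarith [(velocity_mem_of_pos h).2]⟩
  · have hanti : StrictAnti velocity := by
      intro a b hab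
      rcases lt_or_ge 0 a with ha | ha
      · exact strictAntiOn_velocity ha (ha.trans hab) hab
      rcases lt_or_ge b 0 with hb | hb
      · have := strictAntiOn_velocity (neg_pos.2 hb) (neg_pos.2 (hab.trans hb)) (neg_lt_neg hab)
        rw [velocity_neg, velocity_neg] at this
        linarith
      have hb' : velocity b ≤ 0 := by
        rcases hb.eq_or_lt with rfl | hb
        · exact velocity_zero.le
        · exact (velocity_mem_of_pos hb).2.le
      have ha' : 0 ≤ velocity a := by
        rcases ha.eq_or_lt with rfl | ha
        · exact velocity_zero.ge
        · exact (hneg a ha).1.le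
      rcases ha.eq_or_lt with rfl | ha
      · rw [velocity_zero]; exact (velocity_mem_of_pos hab).2
      · exact hb'.trans_lt (hneg a ha).1
    exact hanti.injective.injOn
  · rcases lt_trichotomy u 0 with h | rfl | h
    · obtain ⟨s, -, hs⟩ := exists_pos_velocity_eq ⟨hu.1, h⟩
      exact ⟨s, mem_univ _, hs⟩
    · exact ⟨0, mem_univ _, velocity_zero⟩
    · obtain ⟨s, -, hs⟩ := exists_pos_velocity_eq (u := -u) ⟨by linarith [hu.2], by linarith⟩
      exact ⟨-s, mem_univ _, by rw [velocity_neg, hs, neg_neg]⟩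

/-! ### The normalizer of the step density for small time -/

/-- The normalizing constant of `stepDensity`. -/
noncomputable def stepNormalizer (t : ℝ) : ℝ := ∫ v in (-1 : ℝ)..1, exp (t * √(1 - v ^ 2))

theorem stepNormalizer_zero : stepNormalizer 0 = 2 := by
  simp [stepNormalizer]; norm_num

theorem stepNormalizer_pos (t : ℝ) : 0 < stepNormalizer t :=
  intervalIntegral.intervalIntegral_pos_of_pos
    (Continuous.intervalIntegrable (by fun_prop) _ _) (fun _ => exp_pos _) (by norm_num)

theorem stepNormalizer_bounds {t : ℝ} (h0 : 0 ≤ t) (h1 : t ≤ 1) :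
    2 + t * (π / 2) ≤ stepNormalizer t ∧ stepNormalizer t ≤ 2 + t * (π / 2) + 2 * t ^ 2 := by
  have i1 : ∫ v in (-1 : ℝ)..1, (1 + t * √(1 - v ^ 2)) = 2 + t * (π / 2) := by
    rw [intervalIntegral.integral_add (by simp)
      (Continuous.intervalIntegrable (by fun_prop) _ _), intervalIntegral.integral_const_mul,
      integral_sqrt_one_sub_sq]
    simp; norm_num
  have i2 : ∫ v in (-1 : ℝ)..1, (1 + t * √(1 - v ^ 2) + t ^ 2) = 2 + t * (π / 2) + 2 * t ^ 2 := by
    rw [intervalIntegral.integral_add (Continuous.intervalIntegrable (by fun_prop) _ _)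
      (by simp), i1, intervalIntegral.integral_const]
    norm_num
  rw [← i2, ← i1]
  constructor
  · refine intervalIntegral.integral_mono_on (by norm_num)
      (Continuous.intervalIntegrable (by fun_prop) _ _)
      (Continuous.intervalIntegrable (by fun_prop) _ _) fun v _ => ?_
    linarith [add_one_le_exp (t * √(1 - v ^ 2))]
  · refine intervalIntegral.integral_mono_on (by norm_num)
      (Continuous.intervalIntegrable (by fun_prop) _ _)
      (Continuous.intervalIntegrable (by fun_prop) _ _) fun v _ => ?_
    obtain ⟨hv0, hv1⟩ := sqrt_one_sub_sq_mem_Icc v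
    have hx0 : 0 ≤ t * √(1 - v ^ 2) := by positivity
    have hx1 : t * √(1 - v ^ 2) ≤ t := mul_le_of_le_one_right h0 hv1
    have h := abs_exp_sub_one_sub_id_le (x := t * √(1 - v ^ 2))
      (by rw [abs_of_nonneg hx0]; linarith)
    have h2 := (abs_le.1 h).2
    nlinarith

/-- Source of the constant in `f₂`: to first order `Z(t)/2 = 1 + t π/4`, where `π/4` is the mean of
`√(1 - v²)` under the uniform law. -/
theorem tendsto_stepNormalizer_div_two_pow :
    Tendsto (fun N : ℕ => (stepNormalizer (1 / N) / 2) ^ N) atTop (𝓝 (exp (π / 4))) := by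
  have h : Tendsto (fun N : ℕ => (N : ℝ) * (stepNormalizer (1 / N) / 2 - 1)) atTop
      (𝓝 (π / 4)) := by
    have hz : Tendsto (fun N : ℕ => π / 4 + 1 / (N : ℝ)) atTop (𝓝 (π / 4)) := by
      simpa using (tendsto_one_div_atTop_nhds_zero_nat (𝕜 := ℝ)).const_add (π / 4)
    refine tendsto_of_tendsto_of_tendsto_of_le_of_le' tendsto_const_nhds hz ?_ ?_
    all_goals
      filter_upwards [eventually_ge_atTop 1] with N hN
      have hN' : (1 : ℝ) ≤ N := by exact_mod_cast hN
      have hb := stepNormalizer_bounds (t := 1 / (N : ℝ)) (by positivity)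
        (by rw [div_le_one (by positivity)]; exact hN')
    · have : π / 4 = N * (1 / N * (π / 2) / 2) := by field_simp; norm_num
      rw [this]
      gcongr
      linarith [hb.1]
    · have : π / 4 + 1 / N = (N : ℝ) * ((1 / N * (π / 2) + 2 * (1 / N) ^ 2) / 2) := by
        field_simp; ring
      rw [this]
      gcongr
      linarith [hb.2]
  have := tendsto_one_add_pow_exp_of_tendsto h
  simpa using this

/-! ### The tilted probability law -/

/-- The probability density proportional to `exp (-s v)` on `[-1,1]`. -/
noncomputable def tiltDensity (s v : ℝ) : ℝ :=
  (Icc (-1 : ℝ) 1).indicator (fun v => exp (-(s * v))) v / tiltNormalizer s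

/-- The probability measure with density `tiltDensity s`. -/
noncomputable def tiltMeasure (s : ℝ) : Measure ℝ :=
  volume.withDensity fun v => ENNReal.ofReal (tiltDensity s v)

theorem tiltDensity_nonneg (s v : ℝ) : 0 ≤ tiltDensity s v :=
  div_nonneg (indicator_nonneg (fun _ _ => (exp_pos _).le) _) (tiltNormalizer_pos s).le

theorem measurable_tiltDensity (s : ℝ) : Measurable (tiltDensity s) :=
  (Measurable.indicator (by fun_prop) measurableSet_Icc).div_const _

theorem integrable_tiltDensity (s : ℝ) : Integrable (tiltDensity s) := by
  refine Integrable.div_const ?_ _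
  rw [integrable_indicator_iff measurableSet_Icc]
  exact Continuous.integrableOn_Icc (by fun_prop)

theorem abs_mul_le_of_mem_Icc {s v : ℝ} (hv : v ∈ Icc (-1 : ℝ) 1) : |s * v| ≤ |s| := by
  rw [abs_mul]
  exact mul_le_of_le_one_right (abs_nonneg _) (abs_le.2 hv)

theorem tiltDensity_le (s v : ℝ) : tiltDensity s v ≤ exp |s| / tiltNormalizer s := by
  have := tiltNormalizer_pos s
  unfold tiltDensity
  gcongr
  by_cases hv : v ∈ Icc (-1 : ℝ) 1
  · rw [indicator_of_mem hv, exp_le_exp]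
    linarith [(abs_le.1 (abs_mul_le_of_mem_Icc (s := s) hv)).1]
  · rw [indicator_of_notMem hv]
    positivity

theorem le_tiltDensity {s v : ℝ} (hv : v ∈ Icc (-1 : ℝ) 1) :
    exp (-|s|) / tiltNormalizer s ≤ tiltDensity s v := by
  have := tiltNormalizer_pos s
  unfold tiltDensity
  rw [indicator_of_mem hv]
  gcongr
  linarith [(abs_le.1 (abs_mul_le_of_mem_Icc (s := s) hv)).2]

theorem integral_tiltMeasure (s : ℝ) (F : ℝ → ℝ) :
    ∫ v, F v ∂tiltMeasure s =
      (∫ v in (-1 : ℝ)..1, F v * exp (-(s * v))) / tiltNormalizer s := by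
  rw [tiltMeasure, integral_withDensity_eq_integral_toReal_smul
    (measurable_tiltDensity s).ennreal_ofReal (by simp),
    intervalIntegral.integral_of_le (by norm_num), ← integral_Icc_eq_integral_Ioc,
    ← integral_div, ← integral_indicator measurableSet_Icc]
  refine integral_congr_ae (ae_of_all _ fun v => ?_)
  beta_reduce
  rw [ENNReal.toReal_ofReal (tiltDensity_nonneg s v), smul_eq_mul, tiltDensity]
  by_cases hv : v ∈ Icc (-1 : ℝ) 1
  · simp only [indicator_of_mem hv]; ring
  · simp only [indicator_of_notMem hv]; ring

theorem integral_tiltDensity (s : ℝ) : ∫ v, tiltDensity s v = 1 := by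
  have h : ∫ v, tiltDensity s v = tiltNormalizer s / tiltNormalizer s := by
    simp only [tiltDensity]
    rw [integral_div, integral_indicator measurableSet_Icc, integral_Icc_eq_integral_Ioc,
      ← intervalIntegral.integral_of_le (by norm_num), ← tiltNormalizer]
  rw [h, div_self (tiltNormalizer_pos s).ne']

instance isProbabilityMeasure_tiltMeasure (s : ℝ) : IsProbabilityMeasure (tiltMeasure s) := by
  constructor
  rw [tiltMeasure, withDensity_apply _ MeasurableSet.univ, Measure.restrict_univ,
    ← ofReal_integral_eq_lintegral_ofReal (integrable_tiltDensity s)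
      (ae_of_all _ (tiltDensity_nonneg s)), integral_tiltDensity, ENNReal.ofReal_one]

theorem ae_tiltMeasure_mem_Icc (s : ℝ) : ∀ᵐ v ∂tiltMeasure s, v ∈ Icc (-1 : ℝ) 1 := by
  rw [tiltMeasure, ae_withDensity_iff (measurable_tiltDensity s).ennreal_ofReal]
  refine ae_of_all _ fun v hv => ?_
  by_contra h
  exact hv (by simp [tiltDensity, indicator_of_notMem h])

theorem integral_id_tiltMeasure (s : ℝ) : ∫ v, v ∂tiltMeasure s = velocity s := by
  rw [integral_tiltMeasure, integral_mul_exp_neg, mul_div_cancel_right₀ _ (tiltNormalizer_pos s).ne']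

theorem pi_withDensity_ofReal {ι : Type*} [Fintype ι] {q : ℝ → ℝ} (hq : ∀ v, 0 ≤ q v)
    (hint : Integrable q) :
    Measure.pi (fun _ : ι => volume.withDensity fun v => ENNReal.ofReal (q v)) =
      (volume : Measure (ι → ℝ)).withDensity fun v => ENNReal.ofReal (∏ i, q (v i)) := by
  have : IsFiniteMeasure (volume.withDensity fun v => ENNReal.ofReal (q v)) :=
    isFiniteMeasure_withDensity_ofReal hint.2
  refine Measure.pi_eq fun S hS => ?_
  rw [withDensity_apply _ (MeasurableSet.univ_pi hS), volume_pi, Measure.restrict_pi_pi,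
    ← ofReal_integral_eq_lintegral_ofReal, integral_fintype_prod_eq_prod (fun _ => q),
    ENNReal.ofReal_prod_of_nonneg fun i _ => integral_nonneg hq]
  · refine Finset.prod_congr rfl fun i _ => ?_
    rw [withDensity_apply _ (hS i), ofReal_integral_eq_lintegral_ofReal hint.restrict
      (ae_of_all _ hq)]
  · exact Integrable.fintype_prod fun i => hint.restrict
  · exact ae_of_all _ fun v => Finset.prod_nonneg fun i _ => hq _

theorem integral_pi_tiltMeasure (s : ℝ) {n : ℕ} (F : (Fin n → ℝ) → ℝ) :
    ∫ v, F v ∂Measure.pi (fun _ : Fin n => tiltMeasure s) =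
      ∫ v : Fin n → ℝ, (∏ i, tiltDensity s (v i)) * F v := by
  have := measurable_tiltDensity s
  simp only [tiltMeasure]
  rw [pi_withDensity_ofReal (tiltDensity_nonneg s) (integrable_tiltDensity s),
    integral_withDensity_eq_integral_toReal_smul (by fun_prop) (by simp)]
  simp only [ENNReal.toReal_ofReal (Finset.prod_nonneg fun i _ => tiltDensity_nonneg s _),
    smul_eq_mul]

/-! ### Hoeffding concentration for product measures -/

section Concentration

open ProbabilityTheory

variable {μ : Measure ℝ} [IsProbabilityMeasure μ] {g : ℝ → ℝ} {a b : ℝ}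

/-- Hoeffding's inequality: a variable with values in `[a, b]` is, once centred, sub-Gaussian with
parameter `((b - a)/2)²`, and these parameters add over independent coordinates. -/
theorem pi_measureReal_sum_sub_ge (hg : Measurable g) (hab : a < b)
    (hgab : ∀ᵐ v ∂μ, g v ∈ Icc a b) {ε : ℝ} (hε : 0 < ε) (n : ℕ) :
    (Measure.pi fun _ : Fin n => μ).real {v | ε * n ≤ ∑ i, g (v i) - n * ∫ v, g v ∂μ} ≤
      exp (-(2 * ε ^ 2 / (b - a) ^ 2 * n)) := by
  set m := ∫ v, g v ∂μ
  have hind : iIndepFun (fun (i : Fin n) (v : Fin n → ℝ) => g (v i) - m)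
      (Measure.pi fun _ : Fin n => μ) :=
    iIndepFun_pi (μ := fun _ : Fin n => μ) (X := fun _ x => g x - m)
      fun i => (hg.sub_const m).aemeasurable
  have hsub : ∀ i ∈ (Finset.univ : Finset (Fin n)),
      HasSubgaussianMGF (fun v : Fin n → ℝ => g (v i) - m) ((‖b - a‖₊ / 2) ^ 2)
        (Measure.pi fun _ : Fin n => μ) := by
    intro i _
    have h := hasSubgaussianMGF_of_mem_Icc hg.aemeasurable hgab
    have hev := measurePreserving_eval (fun _ : Fin n => μ) i
    rw [← hev.map_eq] at h
    have := h.of_map hev.measurable.aemeasurable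
    rw [hev.map_eq] at this
    exact this
  have h := HasSubgaussianMGF.measure_sum_ge_le_of_iIndepFun hind hsub
    (ε := ε * n) (by positivity)
  have hset : {v : Fin n → ℝ | ε * n ≤ ∑ i, g (v i) - n * m} =
      {v : Fin n → ℝ | ε * n ≤ ∑ i, (g (v i) - m)} := by
    ext v; simp [Finset.sum_sub_distrib]
  rw [hset]
  refine h.trans (le_of_eq ?_)
  congr 1
  have hba : 0 < b - a := sub_pos.2 hab
  simp only [Finset.sum_const, Finset.card_univ, Fintype.card_fin, nsmul_eq_mul, NNReal.coe_mul,
    NNReal.coe_natCast, NNReal.coe_pow, NNReal.coe_div, coe_nnnorm, norm_eq_abs, abs_of_pos hba,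
    NNReal.coe_ofNat]
  rcases eq_or_ne n 0 with rfl | hn
  · simp
  · have : (n : ℝ) ≠ 0 := by exact_mod_cast hn
    field_simp

theorem pi_measureReal_abs_sum_sub_ge (hg : Measurable g) (hab : a < b)
    (hgab : ∀ᵐ v ∂μ, g v ∈ Icc a b) {ε : ℝ} (hε : 0 < ε) (n : ℕ) :
    (Measure.pi fun _ : Fin n => μ).real {v | ε * n ≤ |∑ i, g (v i) - n * ∫ v, g v ∂μ|} ≤
      2 * exp (-(2 * ε ^ 2 / (b - a) ^ 2 * n)) := by
  have h1 := pi_measureReal_sum_sub_ge hg hab hgab hε n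
  have h2 := pi_measureReal_sum_sub_ge (g := fun v => -g v) (a := -b) (b := -a) hg.neg
    (neg_lt_neg hab) (hgab.mono fun v hv => ⟨neg_le_neg hv.2, neg_le_neg hv.1⟩) hε n
  rw [integral_neg, show -a - -b = b - a by ring] at h2
  have hsub : {v : Fin n → ℝ | ε * n ≤ |∑ i, g (v i) - n * ∫ v, g v ∂μ|} ⊆
      {v | ε * n ≤ ∑ i, g (v i) - n * ∫ v, g v ∂μ} ∪
      {v | ε * n ≤ ∑ i, -g (v i) - n * -∫ v, g v ∂μ} := by
    intro v hv
    rcases le_abs.1 (mem_ofPred.1 hv) with h | h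
    · exact Or.inl h
    · refine Or.inr (mem_ofPred.2 ?_)
      rw [Finset.sum_neg_distrib]
      linarith
  calc _ ≤ _ := measureReal_mono hsub
    _ ≤ _ := measureReal_union_le _ _
    _ ≤ _ := by rw [two_mul]; exact add_le_add h1 h2

end Concentration

/-! ### Subexponential lower bound for the density of the tilted sum -/

/-- The expectation of `ψ (x - (v₁ + ⋯ + vₙ))` for independent `vᵢ` with law `μ`. -/
noncomputable def stepAverage (μ : Measure ℝ) (n : ℕ) (ψ : ℝ → ENNReal) (x : ℝ) : ENNReal :=
  ∫⁻ v, ψ (x - ∑ i, v i) ∂Measure.pi fun _ : Fin n => μ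

section StepAverage

variable {μ : Measure ℝ} [IsProbabilityMeasure μ] {ψ : ℝ → ENNReal}

theorem measurable_stepAverage (n : ℕ) (hψ : Measurable ψ) : Measurable (stepAverage μ n ψ) :=
  Measurable.lintegral_prod_right' (f := fun p : ℝ × (Fin n → ℝ) => ψ (p.1 - ∑ i, p.2 i))
    (by fun_prop)

theorem stepAverage_zero (x : ℝ) : stepAverage μ 0 ψ x = ψ x := by
  simp [stepAverage]

theorem stepAverage_succ (n : ℕ) (hψ : Measurable ψ) (x : ℝ) :
    stepAverage μ (n + 1) ψ x = ∫⁻ w, stepAverage μ n ψ (x - w) ∂μ := by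
  have hmp := measurePreserving_piFinSuccAbove (fun _ : Fin (n + 1) => μ) 0
  have hm : Measurable fun p : ℝ × (Fin n → ℝ) => ψ (x - p.1 - ∑ i, p.2 i) := by fun_prop
  simp only [stepAverage]
  rw [← lintegral_prod (fun p : ℝ × (Fin n → ℝ) => ψ (x - p.1 - ∑ i, p.2 i)) hm.aemeasurable,
    ← hmp.lintegral_comp hm]
  refine lintegral_congr fun v => ?_
  simp [Fin.sum_univ_succ, MeasurableEquiv.piFinSuccAbove, Fin.insertNthEquiv, sub_sub, Fin.tail]

/-- Semigroup property: it lets one block of steps supply a density while the other block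
concentrates. -/
theorem stepAverage_add (k n : ℕ) (hψ : Measurable ψ) (x : ℝ) :
    stepAverage μ (k + n) ψ x = stepAverage μ n (stepAverage μ k ψ) x := by
  induction n generalizing x with
  | zero => rw [stepAverage_zero, add_zero]
  | succ n ih =>
    rw [← add_assoc, stepAverage_succ _ hψ, stepAverage_succ _ (measurable_stepAverage k hψ)]
    exact lintegral_congr fun w => ih _

end StepAverage

theorem ofReal_le_tiltMeasure_Icc {s p q : ℝ} (hp : -1 ≤ p) (hq : q ≤ 1) :
    ENNReal.ofReal (exp (-|s|) / tiltNormalizer s * (q - p)) ≤ tiltMeasure s (Icc p q) := by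
  have hZ := tiltNormalizer_pos s
  rw [tiltMeasure, withDensity_apply _ measurableSet_Icc, ENNReal.ofReal_mul (by positivity),
    ← Real.volume_Icc, ← setLIntegral_const]
  refine setLIntegral_mono (measurable_tiltDensity s).ennreal_ofReal fun v hv => ?_
  exact ENNReal.ofReal_le_ofReal (le_tiltDensity ⟨hp.trans hv.1, hv.2.trans hq⟩)

/-- The density of a sum of `k + 1` steps is at least exponentially small uniformly in a linearly
growing window. -/
theorem exists_pow_le_stepAverage {s u : ℝ} (hu : u ∈ Ioo (-1 : ℝ) 1) :
    ∃ c δ : ℝ, 0 < c ∧ 0 < δ ∧ ∀ (k : ℕ) (x : ℝ), |x - (k + 1) * u| ≤ δ * (k + 1) →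
      ENNReal.ofReal (c ^ (k + 1)) ≤
        stepAverage (tiltMeasure s) k (fun v => ENNReal.ofReal (tiltDensity s v)) x := by
  -- The margin `2δ` leaves room in `[-1, 1]` for an interval of length `δ` next to any `w` with `|w
  -- - u| ≤ δ`.
  obtain ⟨δ, hδ0, hδ1, hδ2⟩ : ∃ δ : ℝ, 0 < δ ∧ u + 2 * δ ≤ 1 ∧ -1 ≤ u - 2 * δ :=
    ⟨min (1 - u) (1 + u) / 2, half_pos (lt_min (by linarith [hu.2]) (by linarith [hu.1])),
      by linarith [min_le_left (1 - u) (1 + u)], by linarith [min_le_right (1 - u) (1 + u)]⟩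
  have hZ := tiltNormalizer_pos s
  set c₀ := exp (-|s|) / tiltNormalizer s with hc₀
  have hc₀pos : 0 < c₀ := by positivity
  refine ⟨c₀ * δ, δ, by positivity, hδ0, fun k => ?_⟩
  have hm := (measurable_tiltDensity s).ennreal_ofReal
  induction k with
  | zero =>
    intro x hx
    rw [stepAverage_zero]
    refine ENNReal.ofReal_le_ofReal ?_
    simp only [Nat.cast_zero, zero_add, one_mul, mul_one, pow_one] at hx ⊢
    obtain ⟨hx1, hx2⟩ := abs_le.1 hx
    refine le_trans ?_ (le_tiltDensity ⟨by linarith, by linarith⟩)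
    exact mul_le_of_le_one_right hc₀pos.le (by linarith)
  | succ k ih =>
    intro x hx
    obtain ⟨w, rfl⟩ : ∃ w, x = (k + 2) * w := ⟨x / (k + 2), by field_simp⟩
    have hw : |w - u| ≤ δ := by
      have h1 : ((k + 2 : ℝ) * w - ((k + 1 : ℕ) + 1) * u) = (k + 2) * (w - u) := by
        push_cast; ring
      have h2 : (δ * ((k + 1 : ℕ) + 1)) = (k + 2) * δ := by push_cast; ring
      rw [h1, h2, abs_mul, abs_of_pos (by positivity)] at hx
      exact le_of_mul_le_mul_left hx (by positivity)
    obtain ⟨hw1, hw2⟩ := abs_le.1 hw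
    have hk : (0 : ℝ) ≤ k := Nat.cast_nonneg k
    -- The new step is taken on the side of `w` away from `u`. What remains is `(k+1)(w - u)`
    -- corrected towards zero by at most `δ`, so it stays in the window for `k + 1` steps.
    obtain ⟨p, hp1, hp2, hp⟩ : ∃ p : ℝ, -1 ≤ p ∧ p + δ ≤ 1 ∧ ∀ v ∈ Icc p (p + δ),
        |(k + 2) * w - v - (k + 1) * u| ≤ δ * (k + 1) := by
      have hkw : |k * (w - u)| ≤ k * δ := by rw [abs_mul, abs_of_nonneg hk]; gcongr
      obtain ⟨e1, e2⟩ := abs_le.1 hkw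
      rcases le_total u w with h | h
      · have hn : 0 ≤ k * (w - u) := mul_nonneg hk (by linarith)
        refine ⟨w, by linarith, by linarith, fun v hv => abs_le.2 ⟨?_, ?_⟩⟩ <;>
          nlinarith [hv.1, hv.2, mul_nonneg hk hδ0.le]
      · have hn : k * (w - u) ≤ 0 := mul_nonpos_of_nonneg_of_nonpos hk (by linarith)
        refine ⟨w - δ, by linarith, by linarith, fun v hv => abs_le.2 ⟨?_, ?_⟩⟩ <;>
          nlinarith [hv.1, hv.2, mul_nonneg hk hδ0.le]
    rw [stepAverage_succ _ hm]
    calc ENNReal.ofReal ((c₀ * δ) ^ (k + 1 + 1))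
        = ENNReal.ofReal ((c₀ * δ) ^ (k + 1)) * ENNReal.ofReal (c₀ * (p + δ - p)) := by
          rw [← ENNReal.ofReal_mul (by positivity)]; congr 1; ring
      _ ≤ ENNReal.ofReal ((c₀ * δ) ^ (k + 1)) * tiltMeasure s (Icc p (p + δ)) := by
          gcongr
          exact ofReal_le_tiltMeasure_Icc hp1 hp2
      _ = ∫⁻ v in Icc p (p + δ), ENNReal.ofReal ((c₀ * δ) ^ (k + 1)) ∂tiltMeasure s := by
          rw [setLIntegral_const]
      _ ≤ ∫⁻ v in Icc p (p + δ), stepAverage (tiltMeasure s) k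
            (fun v => ENNReal.ofReal (tiltDensity s v)) ((k + 2) * w - v) ∂tiltMeasure s := by
          refine setLIntegral_mono ?_ fun v hv => ih _ (hp v hv)
          exact (measurable_stepAverage k hm).comp (by fun_prop)
      _ ≤ _ := setLIntegral_le_lintegral _ _

/-- Spending only a fraction `1/M` of the steps on the lower bound `c^K` makes its exponential cost
as small as desired; `M ≥ |log c| / η` suffices. -/
theorem exists_nat_pow_ge {c η : ℝ} (hc : 0 < c) (hη : 0 < η) :
    ∃ M : ℕ, 2 ≤ M ∧ ∀ K N : ℕ, K * M ≤ N → exp (-(η * N)) ≤ c ^ K := by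
  obtain ⟨M, hM⟩ := exists_nat_ge (max 2 (|log c| / η))
  have h2 : (2 : ℝ) ≤ M := (le_max_left _ _).trans hM
  have h3 : |log c| ≤ η * M := by
    have := (le_max_right _ _).trans hM
    rwa [div_le_iff₀ hη, mul_comm] at this
  refine ⟨M, by exact_mod_cast h2, fun K N hKN => ?_⟩
  have hKN' : (K : ℝ) * M ≤ N := by exact_mod_cast hKN
  rw [← rpow_natCast, rpow_def_of_pos hc, exp_le_exp]
  have h4 : -(η * M) ≤ log c := (abs_le.1 h3).1
  have hK : (0 : ℝ) ≤ K := Nat.cast_nonneg K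
  nlinarith [mul_le_mul_of_nonneg_right h4 hK, mul_le_mul_of_nonneg_left hKN' hη.le]

theorem eventually_two_mul_exp_le {κ : ℝ} (hκ : 0 < κ) :
    ∀ᶠ N : ℕ in atTop, 2 * exp (-(κ * (N / 2))) ≤ 1 / 2 := by
  have h : Tendsto (fun N : ℕ => 2 * exp (-(κ * (N / 2)))) atTop (𝓝 (2 * 0)) := by
    refine Tendsto.const_mul _ (tendsto_exp_neg_atTop_nhds_zero.comp ?_)
    exact (tendsto_natCast_atTop_atTop.atTop_div_const two_pos).const_mul_atTop hκ
  rw [mul_zero] at h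
  exact (h.eventually_lt_const (by norm_num)).mono fun N hN => hN.le

/-- The tilted density of the sum of `N` steps, at its mean, decays subexponentially. -/
theorem eventually_le_stepAverage (s : ℝ) {η : ℝ} (hη : 0 < η) :
    ∀ᶠ N : ℕ in atTop, ENNReal.ofReal (exp (-(η * N)) / 2) ≤
      stepAverage (tiltMeasure s) (N - 1) (fun v => ENNReal.ofReal (tiltDensity s v))
        (N * velocity s) := by
  have hu : velocity s ∈ Ioo (-1 : ℝ) 1 := bijOn_velocity.mapsTo (mem_univ s)
  set u := velocity s with hu_def
  obtain ⟨c, δ, hc, hδ, hlow⟩ := exists_pow_le_stepAverage (s := s) hu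
  obtain ⟨M, hM, hpow⟩ := exists_nat_pow_ge hc hη
  have hMpos : (0 : ℝ) < M := by exact_mod_cast (by omega : 0 < M)
  -- With `K = k + 1 = ⌊N/M⌋` and `b = N - K ≤ 2 M K`, a deviation of `ε b` fits into the window of
  -- width `δ K`.
  set ε := δ / (2 * M)
  have hε : 0 < ε := by positivity
  set κ : ℝ := 2 * ε ^ 2 / (1 - -1) ^ 2
  have hκ : 0 < κ := by positivity
  filter_upwards [eventually_two_mul_exp_le hκ, eventually_ge_atTop M] with N hN hNM
  obtain ⟨k, hk⟩ : ∃ k, N / M = k + 1 :=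
    Nat.exists_eq_succ_of_ne_zero (Nat.div_pos hNM (by omega)).ne'
  have hKM : (k + 1) * M ≤ N := hk ▸ Nat.div_mul_le_self N M
  have hNK : N ≤ 2 * M * (k + 1) := by
    have h1 : N < M * (N / M + 1) := Nat.lt_mul_div_succ N (by omega)
    rw [hk] at h1
    nlinarith
  -- Since `M ≥ 2`, at least `N/2` steps remain for concentration.
  have h2K : 2 * (k + 1) ≤ N := by nlinarith
  obtain ⟨b, rfl⟩ : ∃ b, N = k + 1 + b := Nat.exists_eq_add_of_le (by omega)
  have hm := (measurable_tiltDensity s).ennreal_ofReal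
  -- The averaged density already accounts for one step, so `k` averages give the density of `k + 1`
  -- steps.
  rw [show k + 1 + b - 1 = k + b by omega, stepAverage_add _ _ hm]
  set P := Measure.pi fun _ : Fin b => tiltMeasure s
  set G : Set (Fin b → ℝ) := {v | |∑ i, v i - b * u| ≤ δ * (k + 1)}
  have hG : MeasurableSet G := measurableSet_le (by fun_prop) (by fun_prop)
  have hbad : P.real Gᶜ ≤ 1 / 2 := by
    have hconc := pi_measureReal_abs_sum_sub_ge (μ := tiltMeasure s) (g := fun v => v)
      measurable_id (by norm_num) (ae_tiltMeasure_mem_Icc s) hε b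
    rw [integral_id_tiltMeasure] at hconc
    refine (measureReal_mono fun v hv => ?_).trans (hconc.trans (le_trans ?_ hN))
    · have hv' : δ * (k + 1) < |∑ i, v i - b * u| := not_le.1 hv
      refine mem_ofPred.2 (le_trans ?_ hv'.le)
      have hb : (b : ℝ) ≤ 2 * M * (k + 1) := by exact_mod_cast (by omega : b ≤ 2 * M * (k + 1))
      calc ε * b ≤ ε * (2 * M * (k + 1)) := by gcongr
        _ = δ * (k + 1) := by simp only [ε]; field_simp
    · have hb : ((k + 1 + b : ℕ) : ℝ) / 2 ≤ b := by
        rw [div_le_iff₀ two_pos]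
        exact_mod_cast (by omega : k + 1 + b ≤ b * 2)
      gcongr
  have hgood : ENNReal.ofReal (1 / 2) ≤ P G := by
    have h := probReal_compl_eq_one_sub (μ := P) hG
    rw [ENNReal.ofReal_le_iff_le_toReal (measure_ne_top _ _)]
    change _ ≤ P.real G
    linarith
  calc ENNReal.ofReal (exp (-(η * (k + 1 + b : ℕ))) / 2)
      ≤ ENNReal.ofReal (c ^ (k + 1)) * ENNReal.ofReal (1 / 2) := by
        rw [← ENNReal.ofReal_mul (by positivity)]
        refine ENNReal.ofReal_le_ofReal ?_
        have := hpow _ _ hKM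
        linarith
    _ ≤ ENNReal.ofReal (c ^ (k + 1)) * P G := by gcongr
    _ = ∫⁻ v in G, ENNReal.ofReal (c ^ (k + 1)) ∂P := by rw [setLIntegral_const]
    _ ≤ ∫⁻ v in G, stepAverage (tiltMeasure s) k (fun v => ENNReal.ofReal (tiltDensity s v))
          ((k + 1 + b : ℕ) * u - ∑ i, v i) ∂P := by
        refine setLIntegral_mono ((measurable_stepAverage k hm).comp (by fun_prop))
          fun v hv => hlow k _ ?_
        have hv' : |∑ i, v i - b * u| ≤ δ * (k + 1) := hv
        rw [← abs_neg] at hv'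
        convert hv' using 2
        push_cast; ring
    _ ≤ _ := setLIntegral_le_lintegral _ _

/-! ### Concentration conditionally on the mean -/

theorem abs_exp_sub_exp_le {x y : ℝ} (hx : x ≤ 1) (hy : y ≤ 1) :
    |exp x - exp y| ≤ 3 * |x - y| := by
  wlog h : y ≤ x generalizing x y
  · rw [abs_sub_comm, abs_sub_comm x]
    exact this hy hx (le_of_not_ge h)
  rw [abs_of_nonneg (sub_nonneg.2 (exp_le_exp.2 h)), abs_of_nonneg (sub_nonneg.2 h)]
  have h1 : exp y = exp x * exp (y - x) := by rw [← exp_add]; ring_nf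
  have h2 := add_one_le_exp (y - x)
  have h3 : exp x ≤ 3 := (exp_le_exp.2 hx).trans (by linarith [exp_one_lt_d9])
  rw [h1]
  nlinarith [exp_pos x]

section ConditionalMean

variable (s : ℝ) {g : ℝ → ℝ}

theorem integrable_tiltDensity_comp (n : ℕ) (x : ℝ) :
    Integrable (fun v : Fin n → ℝ => tiltDensity s (x - ∑ i, v i))
      (Measure.pi fun _ => tiltMeasure s) := by
  have := measurable_tiltDensity s
  refine Integrable.of_bound (Measurable.aestronglyMeasurable (by fun_prop))
    (exp |s| / tiltNormalizer s) (ae_of_all _ fun v => ?_)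
  rw [norm_of_nonneg (tiltDensity_nonneg _ _)]
  exact tiltDensity_le _ _

theorem mean_exp_argument_mem (hg : ∀ v, g v ∈ Icc (0 : ℝ) 1) (n : ℕ) (v : Fin n → ℝ) (x : ℝ) :
    1 / ((n + 1 : ℕ) : ℝ) * (∑ i, g (v i) + g x) ∈ Icc (0 : ℝ) 1 := by
  have h0 : 0 ≤ ∑ i, g (v i) := Finset.sum_nonneg fun i _ => (hg _).1
  have h1 : ∑ i, g (v i) ≤ n := by
    simpa using Finset.sum_le_card_nsmul Finset.univ (fun i => g (v i)) 1 fun i _ => (hg _).2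
  have := (hg x).1
  refine ⟨by positivity, ?_⟩
  rw [one_div_mul_eq_div, div_le_one (by positivity)]
  push_cast
  linarith [(hg x).2]

theorem integrable_exp_mul_tiltDensity (hgm : Measurable g) (hg : ∀ v, g v ∈ Icc (0 : ℝ) 1)
    (n : ℕ) (x : ℝ) :
    Integrable (fun v : Fin n → ℝ =>
      exp (1 / ((n + 1 : ℕ) : ℝ) * (∑ i, g (v i) + g (x - ∑ i, v i))) *
        tiltDensity s (x - ∑ i, v i)) (Measure.pi fun _ => tiltMeasure s) := by
  refine (integrable_tiltDensity_comp s n x).bdd_mul (c := exp 1)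
    (Measurable.aestronglyMeasurable (by fun_prop)) (ae_of_all _ fun v => ?_)
  rw [norm_of_nonneg (exp_pos _).le, exp_le_exp]
  exact (mean_exp_argument_mem hg n v _).2

/-- The last step is fixed by the constraint on the sum and need not concentrate; being one of `n +
1`, it costs at most `1/(n+1)`. -/
theorem abs_mean_exp_sub_le (hg : ∀ v, g v ∈ Icc (0 : ℝ) 1) {m : ℝ} (hm : m ∈ Icc (0 : ℝ) 1)
    {ε : ℝ} (hε : 0 < ε) (n : ℕ) (v : Fin n → ℝ) (x : ℝ)
    (hv : |∑ i, g (v i) - n * m| < ε * n) :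
    |exp (1 / ((n + 1 : ℕ) : ℝ) * (∑ i, g (v i) + g x)) - exp m| ≤
      3 * (ε + 1 / ((n + 1 : ℕ) : ℝ)) := by
  refine (abs_exp_sub_exp_le (mean_exp_argument_mem hg n v x).2 hm.2).trans ?_
  gcongr
  have hn : (0 : ℝ) < ((n + 1 : ℕ) : ℝ) := by positivity
  have e : 1 / ((n + 1 : ℕ) : ℝ) * (∑ i, g (v i) + g x) - m =
      (∑ i, g (v i) - n * m + (g x - m)) / ((n + 1 : ℕ) : ℝ) := by
    field_simp
    push_cast
    ring
  have e2 : ε + 1 / ((n + 1 : ℕ) : ℝ) = (ε * ((n + 1 : ℕ) : ℝ) + 1) / ((n + 1 : ℕ) : ℝ) := by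
    field_simp
  rw [e, e2, abs_div, abs_of_pos hn]
  gcongr
  refine (abs_add_le _ _).trans ?_
  have h1 : |g x - m| ≤ 1 := abs_le.2 ⟨by linarith [(hg x).1, hm.2], by linarith [(hg x).2, hm.1]⟩
  push_cast
  nlinarith

/-- Off the Hoeffding event the error is small relative to the density; on it the integrand is
bounded crudely and the probability is exponentially small. -/
theorem abs_integral_exp_sub_le (hgm : Measurable g) (hg : ∀ v, g v ∈ Icc (0 : ℝ) 1)
    {ε : ℝ} (hε : 0 < ε) (n : ℕ) (x : ℝ) :
    |(∫ v : Fin n → ℝ, exp (1 / ((n + 1 : ℕ) : ℝ) * (∑ i, g (v i) + g (x - ∑ i, v i))) *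
        tiltDensity s (x - ∑ i, v i) ∂Measure.pi fun _ => tiltMeasure s) -
      exp (∫ v, g v ∂tiltMeasure s) *
        ∫ v : Fin n → ℝ, tiltDensity s (x - ∑ i, v i) ∂Measure.pi fun _ => tiltMeasure s| ≤
    3 * (ε + 1 / ((n + 1 : ℕ) : ℝ)) *
        (∫ v : Fin n → ℝ, tiltDensity s (x - ∑ i, v i) ∂Measure.pi fun _ => tiltMeasure s) +
      3 * (exp |s| / tiltNormalizer s) * (2 * exp (-(2 * ε ^ 2 * n))) := by
  set m := ∫ v, g v ∂tiltMeasure s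
  set P := Measure.pi fun _ : Fin n => tiltMeasure s
  set K := exp |s| / tiltNormalizer s
  have hK : 0 < K := div_pos (exp_pos _) (tiltNormalizer_pos s)
  have hm : m ∈ Icc (0 : ℝ) 1 := by
    refine ⟨integral_nonneg fun v => (hg v).1, ?_⟩
    have := integral_mono_of_nonneg (μ := tiltMeasure s) (ae_of_all _ fun v => (hg v).1)
      (integrable_const (1 : ℝ)) (ae_of_all _ fun v => (hg v).2)
    simpa using this
  set B : Set (Fin n → ℝ) := {v | ε * n ≤ |∑ i, g (v i) - n * m|}
  have hB : MeasurableSet B := measurableSet_le (by fun_prop) (by fun_prop)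
  have hPB : P.real B ≤ 2 * exp (-(2 * ε ^ 2 * n)) := by
    have := pi_measureReal_abs_sum_sub_ge (μ := tiltMeasure s) hgm zero_lt_one (ae_of_all _ hg) hε n
    simpa using this
  have hq := integrable_tiltDensity_comp s n x
  have hE := integrable_exp_mul_tiltDensity s hgm hg n x
  have hBi : Integrable (B.indicator fun _ => 3 * K) P := (integrable_const _).indicator hB
  rw [← integral_const_mul, ← integral_sub hE (hq.const_mul _)]
  calc _ ≤ ∫ v, (3 * (ε + 1 / ((n + 1 : ℕ) : ℝ)) * tiltDensity s (x - ∑ i, v i) +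
          B.indicator (fun _ => 3 * K) v) ∂P := by
        rw [← norm_eq_abs]
        refine norm_integral_le_of_norm_le ((hq.const_mul _).add hBi) (ae_of_all _ fun v => ?_)
        have hq0 := tiltDensity_nonneg s (x - ∑ i, v i)
        rw [norm_eq_abs, ← sub_mul, abs_mul, abs_of_nonneg hq0]
        by_cases hv : v ∈ B
        · rw [indicator_of_mem hv]
          have h3 := abs_exp_sub_exp_le (mean_exp_argument_mem hg n v (x - ∑ i, v i)).2 hm.2
          have h4 : |1 / ((n + 1 : ℕ) : ℝ) * (∑ i, g (v i) + g (x - ∑ i, v i)) - m| ≤ 1 := by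
            obtain ⟨a1, a2⟩ := mean_exp_argument_mem hg n v (x - ∑ i, v i)
            exact abs_le.2 ⟨by linarith [hm.2], by linarith [hm.1]⟩
          have h5 : 0 ≤ 3 * (ε + 1 / ((n + 1 : ℕ) : ℝ)) * tiltDensity s (x - ∑ i, v i) := by
            positivity
          have h6 := mul_le_mul (h3.trans (by linarith : _ ≤ (3 : ℝ)))
            (tiltDensity_le s (x - ∑ i, v i)) hq0 (by norm_num)
          linarith
        · rw [indicator_of_notMem hv, add_zero]
          exact mul_le_mul_of_nonneg_right
            (abs_mean_exp_sub_le hg hm hε n v _ (not_le.1 hv)) hq0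
    _ ≤ _ := by
        rw [integral_add (hq.const_mul _) hBi, integral_const_mul, integral_indicator hB,
          setIntegral_const, smul_eq_mul, mul_comm (P.real B)]
        gcongr

/-- Conditionally on the mean of `N` tilted steps being the expected one, the mean of `g` over
the steps concentrates at its tilted expectation. -/
theorem tendsto_conditional_exp_mean (hgm : Measurable g) (hg : ∀ v, g v ∈ Icc (0 : ℝ) 1) :
    (∀ᶠ N : ℕ in atTop, 0 < ∫ v : Fin (N - 1) → ℝ,
      tiltDensity s (N * velocity s - ∑ i, v i) ∂Measure.pi fun _ => tiltMeasure s) ∧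
    Tendsto (fun N : ℕ =>
      (∫ v : Fin (N - 1) → ℝ,
        exp (1 / (N : ℝ) * (∑ i, g (v i) + g (N * velocity s - ∑ i, v i))) *
          tiltDensity s (N * velocity s - ∑ i, v i) ∂Measure.pi fun _ => tiltMeasure s) /
      ∫ v : Fin (N - 1) → ℝ,
        tiltDensity s (N * velocity s - ∑ i, v i) ∂Measure.pi fun _ => tiltMeasure s)
      atTop (𝓝 (exp (∫ v, g v ∂tiltMeasure s))) := by
  have hlow : ∀ η > 0, ∀ᶠ N : ℕ in atTop, exp (-(η * N)) / 2 ≤ ∫ v : Fin (N - 1) → ℝ,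
      tiltDensity s (N * velocity s - ∑ i, v i) ∂Measure.pi fun _ => tiltMeasure s := by
    intro η hη
    filter_upwards [eventually_le_stepAverage s hη] with N hN
    rw [stepAverage, ← ofReal_integral_eq_lintegral_ofReal (integrable_tiltDensity_comp s _ _)
      (ae_of_all _ fun v => tiltDensity_nonneg _ _)] at hN
    exact (ENNReal.ofReal_le_ofReal_iff (integral_nonneg fun v => tiltDensity_nonneg _ _)).1 hN
  refine ⟨(hlow 1 one_pos).mono fun N hN => lt_of_lt_of_le (by positivity) hN, ?_⟩
  rw [Metric.tendsto_nhds]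
  intro ε' hε'
  set ε := ε' / 6
  have hε : 0 < ε := by positivity
  set K := exp |s| / tiltNormalizer s
  have hK : 0 < K := div_pos (exp_pos _) (tiltNormalizer_pos s)
  have hlim : Tendsto (fun N : ℕ => 3 * (1 / (N : ℝ)) +
      12 * K * exp (2 * ε ^ 2) * exp (-(ε ^ 2 * N))) atTop (𝓝 0) := by
    have h1 := (tendsto_one_div_atTop_nhds_zero_nat (𝕜 := ℝ)).const_mul 3
    have h2 : Tendsto (fun N : ℕ => exp (-(ε ^ 2 * N))) atTop (𝓝 0) :=
      tendsto_exp_neg_atTop_nhds_zero.comp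
        (tendsto_natCast_atTop_atTop.const_mul_atTop (by positivity))
    simpa using h1.add (h2.const_mul (12 * K * exp (2 * ε ^ 2)))
  -- The Hoeffding error decays at rate `2ε²`. A density lower bound at rate `ε²` leaves a relative
  -- error of order `exp (-ε² N)`, besides `3ε = ε'/2` and `3/N`.
  filter_upwards [hlow (ε ^ 2) (by positivity), eventually_ge_atTop 1,
    hlim.eventually_lt_const (half_pos hε')] with N hN hN1 hsmall
  obtain ⟨n, rfl⟩ : ∃ n, N = n + 1 := ⟨N - 1, by omega⟩
  have hmain := abs_integral_exp_sub_le s hgm hg hε n (((n + 1 : ℕ) : ℝ) * velocity s)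
  set D := ∫ v : Fin n → ℝ, tiltDensity s (((n + 1 : ℕ) : ℝ) * velocity s - ∑ i, v i)
    ∂Measure.pi fun _ => tiltMeasure s
  change _ ≤ D at hN
  change dist (_ / D) _ < ε'
  have hD : 0 < D := lt_of_lt_of_le (by positivity) hN
  rw [Real.dist_eq, div_sub' hD.ne', abs_div, abs_of_pos hD, div_lt_iff₀ hD, mul_comm D]
  refine lt_of_le_of_lt hmain ?_
  have hexp : 3 * K * (2 * exp (-(2 * ε ^ 2 * n))) ≤
      12 * K * exp (2 * ε ^ 2) * exp (-(ε ^ 2 * (n + 1 : ℕ))) * D := by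
    calc 3 * K * (2 * exp (-(2 * ε ^ 2 * n)))
        = 12 * K * exp (2 * ε ^ 2) * exp (-(ε ^ 2 * (n + 1 : ℕ))) *
            (exp (-(ε ^ 2 * (n + 1 : ℕ))) / 2) := by
          have : exp (-(2 * ε ^ 2 * n)) = exp (2 * ε ^ 2) * exp (-(ε ^ 2 * (n + 1 : ℕ))) *
              exp (-(ε ^ 2 * (n + 1 : ℕ))) := by
            rw [← exp_add, ← exp_add]; push_cast; ring_nf
          rw [this]; ring
      _ ≤ _ := by gcongr
  calc _ ≤ (3 * ε + (3 * (1 / ((n + 1 : ℕ) : ℝ)) +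
        12 * K * exp (2 * ε ^ 2) * exp (-(ε ^ 2 * (n + 1 : ℕ))))) * D := by linarith
    _ < ε' * D := by
        gcongr
        have : 3 * ε = ε' / 2 := by simp only [ε]; ring
        linarith

end ConditionalMean

/-! ### Tilting the path density and the limit of its ratio -/

theorem stepDensity_eq (s τ v : ℝ) :
    stepDensity τ v = tiltNormalizer s / stepNormalizer τ *
      (exp (s * v) * exp (τ * √(1 - v ^ 2)) * tiltDensity s v) := by
  have hZ := (tiltNormalizer_pos s).ne'
  rw [stepDensity, tiltDensity, ← stepNormalizer]
  by_cases hv : v ∈ Icc (-1 : ℝ) 1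
  · simp only [indicator_of_mem hv, exp_neg]
    field_simp
  · simp [indicator_of_notMem hv]

/-- The steps sum to `N u`, so the factors `exp (s vᵢ)` that undo the tilt multiply to the constant
`exp (s N u)`, which cancels in the ratio of two times. -/
theorem pathDensity_eq (s t u : ℝ) {N : ℕ} (hN : 1 ≤ N) :
    pathDensity N t u =
      N * ((tiltNormalizer s / stepNormalizer (t / N)) ^ N * exp (s * (N * u))) *
      ∫ v : Fin (N - 1) → ℝ,
        exp (t / N * (∑ i, √(1 - v i ^ 2) + √(1 - (N * u - ∑ i, v i) ^ 2))) *
          tiltDensity s (N * u - ∑ i, v i) ∂Measure.pi fun _ => tiltMeasure s := by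
  rw [pathDensity, integral_pi_tiltMeasure, ← integral_const_mul, ← integral_const_mul]
  refine integral_congr_ae (ae_of_all _ fun v => ?_)
  simp only [stepDensity_eq s, Finset.prod_mul_distrib, Finset.prod_const, Finset.card_univ,
    Fintype.card_fin, ← exp_sum, ← Finset.mul_sum]
  obtain ⟨n, rfl⟩ : ∃ n, N = n + 1 := ⟨N - 1, by omega⟩
  have h1 : exp (s * (((n + 1 : ℕ) : ℝ) * u)) = exp (s * ∑ i, v i) *
      exp (s * (((n + 1 : ℕ) : ℝ) * u - ∑ i, v i)) := by
    rw [← exp_add]; ring_nf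
  rw [h1, mul_add, exp_add, pow_succ _ n]
  simp only [Nat.add_sub_cancel]
  ring

theorem tendsto_pathDensity_ratio (s : ℝ) :
    (∀ᶠ N : ℕ in atTop, pathDensity N 0 (velocity s) ≠ 0) ∧
    Tendsto (fun N : ℕ => pathDensity N 1 (velocity s) / pathDensity N 0 (velocity s)) atTop
      (𝓝 (exp (∫ v, √(1 - v ^ 2) ∂tiltMeasure s - π / 4))) := by
  obtain ⟨hpos, hlim⟩ := tendsto_conditional_exp_mean s (g := fun v => √(1 - v ^ 2))
    (by fun_prop) sqrt_one_sub_sq_mem_Icc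
  have h0 : ∀ N : ℕ, 1 ≤ N → pathDensity N 0 (velocity s) =
      N * ((tiltNormalizer s / 2) ^ N * exp (s * (N * velocity s))) *
      ∫ v : Fin (N - 1) → ℝ, tiltDensity s (N * velocity s - ∑ i, v i)
        ∂Measure.pi fun _ => tiltMeasure s := by
    intro N hN
    rw [pathDensity_eq s _ _ hN]
    simp [stepNormalizer_zero]
  have hZ := tiltNormalizer_pos s
  refine ⟨?_, ?_⟩
  · filter_upwards [hpos, eventually_ge_atTop 1] with N hN hN1
    rw [h0 N hN1]
    have : (0 : ℝ) < N := by exact_mod_cast hN1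
    positivity
  · rw [sub_eq_add_neg, exp_add, exp_neg]
    refine (hlim.mul (tendsto_stepNormalizer_div_two_pow.inv₀ (exp_pos _).ne')).congr' ?_
    filter_upwards [hpos, eventually_ge_atTop 1] with N hN hN1
    have hN0 : (N : ℝ) ≠ 0 := by exact_mod_cast (by omega : N ≠ 0)
    have hc := (stepNormalizer_pos (1 / N)).ne'
    rw [h0 N hN1, pathDensity_eq s _ _ hN1, div_pow, div_pow, div_pow]
    have hD := hN.ne'
    field_simp

/-! ### Tilted expectations and comparison with the ansatz -/

theorem integral_sqrt_tiltMeasure {s : ℝ} (hs : s ≠ 0) :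
    ∫ v, √(1 - v ^ 2) ∂tiltMeasure s = π / 2 * (besselI1 s / sinh s) := by
  have : sinh s ≠ 0 := by simpa using hs
  rw [integral_tiltMeasure, integral_sqrt_mul_exp_neg hs, tiltNormalizer_eq hs]
  field_simp

theorem integral_sqrt_tiltMeasure_zero : ∫ v, √(1 - v ^ 2) ∂tiltMeasure 0 = π / 4 := by
  rw [integral_tiltMeasure, tiltNormalizer_zero]
  simp only [zero_mul, neg_zero, exp_zero, mul_one, integral_sqrt_one_sub_sq]
  ring

theorem AsymptoticAnsatz.differentiableAt {y : ℝ → ℝ} {f : ℝ → ℝ → ℝ} {A : ℕ → ℝ → ℝ}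
    (h : AsymptoticAnsatz y f A) {u : ℝ} (hu : u ∈ Ioo (-1 : ℝ) 1) (τ : ℝ) :
    DifferentiableAt ℝ (fun τ => f τ (y u)) τ := by
  have hopen : IsOpen ((univ : Set ℝ) ×ˢ Ioo (-1 : ℝ) 1) := isOpen_univ.prod isOpen_Ioo
  have h1 : DifferentiableAt ℝ (fun q : ℝ × ℝ => f q.1 (y q.2)) (τ, u) :=
    (h.contDiffOn.differentiableOn (by norm_num)).differentiableAt
      (hopen.mem_nhds ⟨mem_univ _, hu⟩)
  exact h1.comp τ (f := fun τ : ℝ => (τ, u)) (by fun_prop)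

theorem AsymptoticAnsatz.tendsto_ratio {y : ℝ → ℝ} {f : ℝ → ℝ → ℝ} {A : ℕ → ℝ → ℝ}
    (h : AsymptoticAnsatz y f A) {u : ℝ} (hu : u ∈ Ioo (-1 : ℝ) 1)
    (hne : ∀ᶠ N : ℕ in atTop, pathDensity N 0 u ≠ 0) :
    Tendsto (fun N : ℕ => pathDensity N 1 u / pathDensity N 0 u) atTop
      (𝓝 (exp (deriv (fun τ => f τ (y u)) 0))) := by
  obtain ⟨r₀, hr₀, h₀⟩ := h.asymptotics 0 le_rfl u hu
  obtain ⟨r₁, hr₁, h₁⟩ := h.asymptotics 1 zero_le_one u hu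
  have hz := tendsto_one_div_atTop_nhds_zero_nat (𝕜 := ℝ)
  have t₀ := (hr₀.trans_tendsto hz).const_add 1
  have t₁ := (hr₁.trans_tendsto hz).const_add 1
  have hslope := (h.differentiableAt hu 0).hasDerivAt.tendsto_slope_zero
  have hz' : Tendsto (fun N : ℕ => 1 / (N : ℝ)) atTop (𝓝[≠] 0) := by
    refine tendsto_nhdsWithin_iff.2 ⟨hz, ?_⟩
    filter_upwards [eventually_ge_atTop 1] with N hN
    have : (0 : ℝ) < N := by exact_mod_cast hN
    exact (one_div_pos.2 this).ne'
  have hlim := ((continuous_exp.tendsto _).comp (hslope.comp hz')).mul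
    (t₁.div t₀ (by norm_num))
  simp only [add_zero, div_one, mul_one] at hlim
  refine hlim.congr' ?_
  filter_upwards [h₀, h₁, hne] with N e₀ e₁ hN
  rw [e₀] at hN
  -- Nonvanishing of the density at `t = 0` makes `A_N` and `1 + r₀` nonzero, so they may be
  -- cancelled or divided by.
  have hA : A N (y u) ≠ 0 := fun h => hN (by simp [h])
  have hr : 1 + r₀ N ≠ 0 := fun h => hN (by simp [h])
  rw [e₀, e₁]
  simp only [Function.comp, one_div, inv_inv, smul_eq_mul, zero_add, zero_div, mul_sub, exp_sub,
    Pi.div_apply]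
  field_simp

theorem AsymptoticAnsatz.deriv_eq {y : ℝ → ℝ} {f : ℝ → ℝ → ℝ} {A : ℕ → ℝ → ℝ}
    (h : AsymptoticAnsatz y f A) (s : ℝ) :
    deriv (fun τ => f τ (y (velocity s))) 0 = ∫ v, √(1 - v ^ 2) ∂tiltMeasure s - π / 4 := by
  obtain ⟨hne, hlim⟩ := tendsto_pathDensity_ratio s
  exact exp_injective (tendsto_nhds_unique
    (h.tendsto_ratio (bijOn_velocity.mapsTo (mem_univ s)) hne) hlim)

theorem theorem3p2 (y : ℝ → ℝ) (f : ℝ → ℝ → ℝ) (A : ℕ → ℝ → ℝ)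
    (h : AsymptoticAnsatz y f A) (f₂ : ℝ → ℝ)
    (hf₂ : ∀ u ∈ Ioo (-1 : ℝ) 1, f₂ u = deriv (fun τ : ℝ => f τ (y u)) 0) :
    BijOn velocity univ (Ioo (-1 : ℝ) 1) ∧
      (∀ s : ℝ, s ≠ 0 → ∀ u : ℝ, u = velocity s →
        f₂ u = π / 2 * (besselI1 s / sinh s - 1 / 2)) ∧
      f₂ 0 = 0 := by
  have key : ∀ s, f₂ (velocity s) = ∫ v, √(1 - v ^ 2) ∂tiltMeasure s - π / 4 := fun s => by
    rw [hf₂ _ (bijOn_velocity.mapsTo (mem_univ s)), h.deriv_eq]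
  refine ⟨bijOn_velocity, ?_, ?_⟩
  · rintro s hs u rfl
    rw [key, integral_sqrt_tiltMeasure hs]
    ring
  · have := key 0
    rwa [velocity_zero, integral_sqrt_tiltMeasure_zero, sub_self] at this
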